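/- Let $K\subset\mathbb R^d$ be a compact set which is Ahlfors regular, that is, there are constants $s,c_1,c_2,r_0>0$ such that $\dim_{\mathcal H}(K)=s$ and $c_1r^s\le\mathcal H^s(K\cap B(x,r))\le c_2r^s$ for all $x\in K$ and all $0<r<r_0$, where $\mathcal H^s$ is the $s$-dimensional Hausdorff measure and $\dim_{\mathcal H}$ the Hausdorff dimension. Let $\mathcal P(K)$ be the set of Borel probability measures on $K$, endowed with the weak topology. For $\mu\in\mathcal P(K)$ and $x\in K$ let $$\overline{\dim}_{\rm loc}(\mu;x)=\limsup_{r\to0^+}\frac{\log\mu(B(x,r))}{\log r}\in[0,+\infty]$$ be the upper local dimension of $\mu$ at $x$, and let $\dim_{\mathcal P}(K)$ be the packing dimension of $K$. Then a typical $\mu\in\mathcal P(K)$ satisfies $$\overline{\dim}_{\rm loc}(\mu;x)=\dim_{\mathcal P}(K)\quad\text{for $\mu$-almost every }x\in K;$$ that is, there is a dense $G_\delta$ subset of $\mathcal P(K)$ all of whose elements $\mu$ have this property. In particular, a typical $\mu\in\mathcal P(K)$ is monodimensional for the upper local dimension: $\overline{\dim}_{\rm loc}(\mu;x)$ is constant for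 $\mu$-almost every $x$. -/

import Mathlib

open MeasureTheory Filter Topology Set
open scoped ENNReal NNReal

namespace Fractal

/-- The upper local dimension `limsup_{r → 0⁺} log μ(B(x, r)) / log r` of `μ` at `x`, as an extended
real number. Here `log 0 = -∞`, so the value is `+∞` at every point outside the support of `μ`. -/
noncomputable def upperLocalDim {X : Type*} [PseudoMetricSpace X] [MeasurableSpace X]
    (μ : Measure X) (x : X) : EReal :=
  limsup (fun r : ℝ => ENNReal.log (μ (Metric.ball x r)) / ((Real.log r : ℝ) : EReal)) (𝓝[>] 0)

/-- A measure is monodimensional for the upper local dimension if its upper local dimension is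
almost everywhere equal to a constant. -/
def IsUpperMonodimensional {X : Type*} [PseudoMetricSpace X] [MeasurableSpace X]
    (μ : Measure X) : Prop :=
  ∃ D : EReal, ∀ᵐ x ∂μ, upperLocalDim μ x = D

/-- A finite `δ`-packing of `E`: finitely many pairwise disjoint closed balls with centre in `E`
and radius in `(0, δ]`, a ball being encoded as the pair (centre, radius). -/
structure IsPacking {X : Type*} [PseudoMetricSpace X] (E : Set X) (δ : ℝ)
    (t : Finset (X × ℝ)) : Prop where
  center_mem : ∀ p ∈ t, p.1 ∈ E
  radius_pos : ∀ p ∈ t, 0 < p.2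
  radius_le : ∀ p ∈ t, p.2 ≤ δ
  disjoint : (t : Set (X × ℝ)).PairwiseDisjoint fun p => Metric.closedBall p.1 p.2

/-- `P₀^s_δ(E)`: the supremum of `∑ (2 rᵢ)^s` over the `δ`-packings of `E`. Countable packings give
the same value, since a sum of nonnegative terms is the supremum of its finite partial sums. -/
noncomputable def packingPreContent {X : Type*} [PseudoMetricSpace X] (s : ℝ≥0) (δ : ℝ)
    (E : Set X) : ℝ≥0∞ :=
  ⨆ (t : Finset (X × ℝ)) (_ : IsPacking E δ t), ∑ p ∈ t, ENNReal.ofReal (2 * p.2) ^ (s : ℝ)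

/-- The packing premeasure `P₀^s(E)`, the decreasing limit of `P₀^s_δ(E)` as `δ → 0⁺`. -/
noncomputable def packingPremeasure {X : Type*} [PseudoMetricSpace X] (s : ℝ≥0)
    (E : Set X) : ℝ≥0∞ :=
  ⨅ (δ : ℝ) (_ : 0 < δ), packingPreContent s δ E

/-- The `s`-dimensional packing measure `P^s(E)`. -/
noncomputable def packingMeasure {X : Type*} [PseudoMetricSpace X] (s : ℝ≥0)
    (E : Set X) : ℝ≥0∞ :=
  ⨅ (F : ℕ → Set X) (_ : E ⊆ ⋃ i, F i), ∑' i, packingPremeasure s (F i)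

/-- The packing dimension `sup {s ≥ 0 : P^s(E) = ∞}` (with `sup ∅ = 0`). -/
noncomputable def packingDim {X : Type*} [PseudoMetricSpace X] (E : Set X) : ℝ≥0∞ :=
  ⨆ (s : ℝ≥0) (_ : packingMeasure s E = ∞), (s : ℝ≥0∞)

/-- Ahlfors regular subsets of `ℝ^d`; `hausdorffMeasure s` is the `s`-dimensional Hausdorff measure. -/
def IsAhlforsRegular {d : ℕ} (K : Set (EuclideanSpace ℝ (Fin d))) : Prop :=
  ∃ s c₁ c₂ r₀ : ℝ, 0 < s ∧ 0 < c₁ ∧ 0 < c₂ ∧ 0 < r₀ ∧ dimH K = ENNReal.ofReal s ∧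
    ∀ x ∈ K, ∀ r : ℝ, 0 < r → r < r₀ →
      ENNReal.ofReal (c₁ * r ^ s) ≤ Measure.hausdorffMeasure s (K ∩ Metric.ball x r) ∧
      Measure.hausdorffMeasure s (K ∩ Metric.ball x r) ≤ ENNReal.ofReal (c₂ * r ^ s)

/-- A property holds for a typical element of `X` if it is satisfied by all the elements of some
dense `G_δ` set. -/
def Typically {X : Type*} [TopologicalSpace X] (p : X → Prop) : Prop :=
  ∃ S : Set X, IsGδ S ∧ Dense S ∧ ∀ x ∈ S, p x

end Fractal

/-! Let `m` be `H^s` restricted to `K`. Regularity makes `m` finite and nonzero, with balls of mass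
comparable to `r ^ s`. Comparing packings with `m` gives packing dimension `s`
(`packingDim_eq_of_regular`), so the task is to show that the upper local dimension is typically
`s`. The bound `≤ s` holds almost everywhere for every measure: separated sets have `O(r ^ (-s))`
points, so balls of mass below `r ^ t` with `t > s` cover little, and Borel–Cantelli applies
(`ae_upperLocalDim_le`). The bound `≥ s` needs only arbitrarily small radii at which all balls are
light. For a typical measure it holds at every point: Frostman measures are interior to each
`smallBallMeasures` set (`frostmanMeasures_subset_interior`) and dense (`dense_frostmanMeasures`),
so the intersection of those interiors is a dense `G_δ`. -/

namespace Fractal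

/-! ### Packing dimension of a regular set -/

section Packing

variable {X : Type*}

/-- A totally bounded set has a finite `r`-separated subset which is `r`-dense in it. -/
theorem exists_finset_separated_cover [PseudoMetricSpace X] {A : Set X} (hA : TotallyBounded A)
    {r : ℝ} (hr : 0 < r) :
    ∃ T : Finset X, (T : Set X) ⊆ A ∧ (T : Set X).Pairwise (fun x y => r < dist x y) ∧
      A ⊆ ⋃ x ∈ T, Metric.closedBall x r := by
  lift r to ℝ≥0 using hr.le
  have hr' : r ≠ 0 := by rintro rfl; simp at hr
  have hfin : Metric.packingNumber r A ≠ ⊤ := by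
    obtain ⟨N, -, hN, hcov⟩ :=
      Metric.exists_finite_isCover_of_totallyBounded (ε := r / 2) (by positivity) hA
    have h1 := Metric.packingNumber_two_mul_le_externalCoveringNumber (r / 2) A
    rw [mul_div_cancel₀ _ two_ne_zero] at h1
    refine ((h1.trans hcov.externalCoveringNumber_le_encard).trans_lt ?_).ne
    exact hN.encard_lt_top
  have hTfin : (Metric.maximalSeparatedSet r A).Finite := by
    rw [← Set.encard_ne_top_iff, Metric.encard_maximalSeparatedSet hfin]
    exact hfin
  refine ⟨hTfin.toFinset, by simpa using Metric.maximalSeparatedSet_subset, ?_, ?_⟩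
  · intro x hx y hy hxy
    have : (r : ℝ≥0∞) < edist x y :=
      Metric.isSeparated_maximalSeparatedSet (by simpa using hx) (by simpa using hy) hxy
    rw [edist_nndist] at this
    rw [← coe_nndist]
    exact_mod_cast this
  · have := Metric.isCover_maximalSeparatedSet hfin
    rw [Metric.isCover_iff_subset_iUnion_closedBall] at this
    simpa using this

theorem isPacking_product_singleton [PseudoMetricSpace X] {A : Set X} {r : ℝ} (hr : 0 < r)
    {T : Finset X} (hTA : (T : Set X) ⊆ A)
    (hT : (T : Set X).Pairwise fun x y => 2 * r < dist x y) :
    IsPacking A r (T ×ˢ {r}) where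
  center_mem p hp := hTA (by simpa using (Finset.mem_product.1 hp).1)
  radius_pos p hp := by
    obtain ⟨-, h⟩ := Finset.mem_product.1 hp
    rwa [Finset.mem_singleton.1 h]
  radius_le p hp := by
    obtain ⟨-, h⟩ := Finset.mem_product.1 hp
    rw [Finset.mem_singleton.1 h]
  disjoint := by
    rintro ⟨x, a⟩ hx ⟨y, b⟩ hy hxy
    simp only [Finset.coe_product, Finset.coe_singleton, mem_prod, mem_singleton_iff] at hx hy
    obtain ⟨hx, rfl⟩ := hx
    obtain ⟨hy, rfl⟩ := hy
    apply Metric.closedBall_disjoint_closedBall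
    have := hT hx hy (by rintro rfl; exact hxy rfl)
    linarith

variable [PseudoMetricSpace X] [MeasurableSpace X] {m : Measure X}
  {K : Set X} {s : ℝ}

theorem IsPacking.sum_rpow_le_measure [OpensMeasurableSpace X]
    (hK : MeasurableSet K) {c : ℝ}
    (hlow : ∀ x ∈ K, ∀ r : ℝ, 0 < r → r ≤ 1 → ENNReal.ofReal (c * r ^ s) ≤ m (K ∩ Metric.ball x r))
    {δ : ℝ} (hδ : δ ≤ 1) {t : Finset (X × ℝ)} (ht : IsPacking K δ t) :
    ∑ p ∈ t, ENNReal.ofReal (c * p.2 ^ s) ≤ m K :=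
  calc ∑ p ∈ t, ENNReal.ofReal (c * p.2 ^ s)
      ≤ ∑ p ∈ t, m (K ∩ Metric.ball p.1 p.2) := Finset.sum_le_sum fun p hp =>
        hlow _ (ht.center_mem p hp) _ (ht.radius_pos p hp) ((ht.radius_le p hp).trans hδ)
    _ = m (⋃ p ∈ t, K ∩ Metric.ball p.1 p.2) := by
        refine (measure_biUnion_finset ?_ fun p _ => hK.inter Metric.isOpen_ball.measurableSet).symm
        exact ht.disjoint.mono fun p => inter_subset_right.trans Metric.ball_subset_closedBall
    _ ≤ m K := measure_mono (iUnion₂_subset fun _ _ => inter_subset_left)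

theorem card_mul_le_measure [OpensMeasurableSpace X]
    (hK : MeasurableSet K) {c : ℝ}
    (hlow : ∀ x ∈ K, ∀ r : ℝ, 0 < r → r ≤ 1 → ENNReal.ofReal (c * r ^ s) ≤ m (K ∩ Metric.ball x r))
    {r : ℝ} (hr : 0 < r) (hr1 : r ≤ 1) {T : Finset X} (hTK : (T : Set X) ⊆ K)
    (hT : (T : Set X).Pairwise fun x y => 2 * r < dist x y) :
    (T.card : ℝ≥0∞) * ENNReal.ofReal (c * r ^ s) ≤ m K := by
  have := (isPacking_product_singleton hr hTK hT).sum_rpow_le_measure hK hlow hr1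
  simpa [Finset.sum_product] using this

/-- Disjoint balls have total mass at most `m K`, and `r ^ t ≤ r ^ s` for radii at most `1`, so
packing sums are bounded. -/
theorem packingPremeasure_lt_top [OpensMeasurableSpace X]
    (hK : MeasurableSet K) (hmK : m K ≠ ∞) {c : ℝ}
    (hc : 0 < c)
    (hlow : ∀ x ∈ K, ∀ r : ℝ, 0 < r → r ≤ 1 → ENNReal.ofReal (c * r ^ s) ≤ m (K ∩ Metric.ball x r))
    {t : ℝ≥0} (hst : s ≤ t) : packingPremeasure t K < ∞ := by
  have hC : ENNReal.ofReal (2 ^ (t : ℝ) / c) * m K < ∞ :=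
    ENNReal.mul_lt_top ENNReal.ofReal_lt_top hmK.lt_top
  refine lt_of_le_of_lt (iInf₂_le_of_le 1 one_pos (iSup₂_le fun P hP => ?_)) hC
  refine le_trans ?_ (mul_le_mul_right (hP.sum_rpow_le_measure hK hlow le_rfl) _)
  rw [Finset.mul_sum]
  refine Finset.sum_le_sum fun p hp => ?_
  have hp0 := hP.radius_pos p hp
  rw [ENNReal.ofReal_rpow_of_pos (by positivity), ← ENNReal.ofReal_mul (by positivity)]
  refine ENNReal.ofReal_le_ofReal ?_
  rw [Real.mul_rpow zero_le_two hp0.le]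
  have : p.2 ^ (t : ℝ) ≤ p.2 ^ s :=
    Real.rpow_le_rpow_of_exponent_ge hp0 (hP.radius_le p hp) hst
  calc (2 : ℝ) ^ (t : ℝ) * p.2 ^ (t : ℝ) ≤ 2 ^ (t : ℝ) * p.2 ^ s := by gcongr
    _ = 2 ^ (t : ℝ) / c * (c * p.2 ^ s) := by field_simp

/-- A maximal `2r`-separated subset of `K ∩ F` is the set of centres of an `r`-packing of `F`, so it
has `O(r ^ (-t))` points. The balls of radius `3r` about them cover `K ∩ F`, with total mass `O(r ^
(s - t))`, which tends to `0`. -/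
theorem measure_inter_eq_zero_of_packingPremeasure_ne_top (hKb : TotallyBounded K) {c : ℝ}
    (hup : ∀ x ∈ K, ∀ r : ℝ, 0 < r → m (K ∩ Metric.ball x r) ≤ ENNReal.ofReal (c * r ^ s))
    {t : ℝ≥0} (hts : (t : ℝ) < s) {F : Set X} (hF : packingPremeasure t F ≠ ∞) :
    m (K ∩ F) = 0 := by
  obtain ⟨δ, hδ, hM⟩ : ∃ δ : ℝ, 0 < δ ∧ packingPreContent t δ F < ∞ := by
    simpa [packingPremeasure, iInf_lt_iff] using hF.lt_top
  set M := packingPreContent t δ F with hMdef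
  have key : ∀ r : ℝ, 0 < r → r < δ →
      m (K ∩ F) ≤ M * ENNReal.ofReal (c * 3 ^ s / 2 ^ (t : ℝ) * r ^ (s - t)) := by
    intro r hr hrδ
    obtain ⟨T, hTA, hT, hcov⟩ := exists_finset_separated_cover
      (hKb.subset (inter_subset_left : K ∩ F ⊆ K)) (r := 2 * r) (by positivity)
    have hpack := isPacking_product_singleton hr (hTA.trans inter_subset_right) hT
    have hpack' : IsPacking F δ (T ×ˢ {r}) :=
      ⟨hpack.center_mem, hpack.radius_pos, fun p hp => (hpack.radius_le p hp).trans hrδ.le,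
        hpack.disjoint⟩
    have hcard : (T.card : ℝ≥0∞) * ENNReal.ofReal (2 * r) ^ (t : ℝ) ≤ M := by
      have : ∑ p ∈ T ×ˢ {r}, ENNReal.ofReal (2 * p.2) ^ (t : ℝ) ≤ M :=
        le_iSup₂_of_le (T ×ˢ {r}) hpack' le_rfl
      simpa [Finset.sum_product] using this
    calc m (K ∩ F) ≤ m (⋃ x ∈ T, K ∩ Metric.ball x (3 * r)) := by
          refine measure_mono fun z hz => ?_
          obtain ⟨x, hx, hzx⟩ := mem_iUnion₂.1 (hcov hz)
          refine mem_iUnion₂.2 ⟨x, hx, hz.1, ?_⟩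
          exact Metric.closedBall_subset_ball (by linarith) hzx
      _ ≤ ∑ x ∈ T, m (K ∩ Metric.ball x (3 * r)) := measure_biUnion_finset_le _ _
      _ ≤ ∑ x ∈ T, ENNReal.ofReal (c * (3 * r) ^ s) :=
          Finset.sum_le_sum fun x hx => hup x (hTA hx).1 _ (by positivity)
      _ = T.card * ENNReal.ofReal (2 * r) ^ (t : ℝ) *
            ENNReal.ofReal (c * 3 ^ s / 2 ^ (t : ℝ) * r ^ (s - t)) := by
          rw [Finset.sum_const, nsmul_eq_mul, ENNReal.ofReal_rpow_of_pos (by positivity), mul_assoc,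
            ← ENNReal.ofReal_mul (by positivity)]
          congr 2
          rw [Real.mul_rpow (by norm_num) hr.le, Real.mul_rpow (by norm_num) hr.le,
            Real.rpow_sub hr]
          field_simp
      _ ≤ _ := by gcongr
  have hlim : Tendsto (fun r : ℝ => M * ENNReal.ofReal (c * 3 ^ s / 2 ^ (t : ℝ) * r ^ (s - t)))
      (𝓝[>] 0) (𝓝 0) := by
    have h1 : Tendsto (fun r : ℝ => r ^ (s - t)) (𝓝[>] 0) (𝓝 0) := by
      have := (Real.continuous_rpow_const (q := s - t) (by linarith)).tendsto 0
      rw [Real.zero_rpow (by linarith)] at this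
      exact this.mono_left nhdsWithin_le_nhds
    have h2 := ENNReal.tendsto_ofReal (h1.const_mul (c * 3 ^ s / 2 ^ (t : ℝ)))
    have h3 := ENNReal.Tendsto.const_mul h2 (Or.inr hM.ne)
    simpa using h3
  refine le_antisymm (ge_of_tendsto hlim ?_) zero_le
  filter_upwards [Ioo_mem_nhdsGT hδ] with r hr using key r hr.1 hr.2

theorem packingDim_eq_of_regular [OpensMeasurableSpace X]
    (hs : 0 < s) (hK : MeasurableSet K) (hKb : TotallyBounded K)
    (hmK : m K ≠ ∞) (hmK0 : m K ≠ 0) {c₁ c₂ : ℝ} (hc₁ : 0 < c₁)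
    (hlow : ∀ x ∈ K, ∀ r : ℝ, 0 < r → r ≤ 1 →
      ENNReal.ofReal (c₁ * r ^ s) ≤ m (K ∩ Metric.ball x r))
    (hup : ∀ x ∈ K, ∀ r : ℝ, 0 < r → m (K ∩ Metric.ball x r) ≤ ENNReal.ofReal (c₂ * r ^ s)) :
    packingDim K = ENNReal.ofReal s := by
  apply le_antisymm
  · refine iSup₂_le fun t ht => ?_
    rw [← ENNReal.ofReal_coe_nnreal]
    refine ENNReal.ofReal_le_ofReal ?_
    by_contra! hst
    refine (packingPremeasure_lt_top hK hmK hc₁ hlow hst.le).ne (top_le_iff.1 ?_)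
    rw [← ht]
    refine iInf₂_le_of_le (fun i : ℕ => if i = 0 then K else ∅)
      (subset_iUnion_of_subset 0 (by simp)) ?_
    rw [tsum_eq_single 0]
    · simp
    · intro i hi
      simp only [hi, if_false]
      refine le_antisymm (iInf₂_le_of_le 1 one_pos (iSup₂_le fun P hP => ?_)) zero_le
      rw [Finset.sum_eq_zero]
      intro p hp
      exact (hP.center_mem p hp).elim
  · refine le_of_forall_lt fun a ha => ?_
    obtain ⟨t, hat, hts⟩ := ENNReal.lt_iff_exists_nnreal_btwn.1 ha
    refine hat.trans_le (le_iSup₂_of_le t ?_ le_rfl)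
    have hts' : (t : ℝ) < s := by
      rw [← ENNReal.ofReal_coe_nnreal] at hts
      exact (ENNReal.ofReal_lt_ofReal_iff hs).1 hts
    refine iInf₂_eq_top.2 fun F hF => ?_
    by_contra hne
    apply hmK0
    have hz : m (⋃ i, K ∩ F i) = 0 := measure_iUnion_null fun i =>
      measure_inter_eq_zero_of_packingPremeasure_ne_top hKb hup hts'
        (ENNReal.ne_top_of_tsum_ne_top hne i)
    rwa [← inter_iUnion, inter_eq_left.2 hF] at hz

end Packing

/-! ### Upper local dimension: the almost everywhere upper bound -/

section LocalDimension

theorem log_div_log_le {r t : ℝ} (hr : 0 < r) (hr1 : r < 1) {M : ℝ≥0∞}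
    (h : ENNReal.ofReal (r ^ t) ≤ M) : ENNReal.log M / ((Real.log r : ℝ) : EReal) ≤ t := by
  have hlog : Real.log r < 0 := Real.log_neg hr hr1
  have := EReal.div_le_div_right_of_nonpos (c := (Real.log r : EReal))
    (by exact_mod_cast hlog.le) (ENNReal.log_monotone h)
  rwa [ENNReal.log_ofReal_of_pos (by positivity), Real.log_rpow hr, ← EReal.coe_div,
    mul_div_cancel_right₀ _ hlog.ne] at this

theorem le_log_div_log {r t : ℝ} (hr : 0 < r) (hr1 : r < 1) {M : ℝ≥0∞}
    (h : M ≤ ENNReal.ofReal (r ^ t)) : t ≤ ENNReal.log M / ((Real.log r : ℝ) : EReal) := by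
  have hlog : Real.log r < 0 := Real.log_neg hr hr1
  have := EReal.div_le_div_right_of_nonpos (c := (Real.log r : EReal))
    (by exact_mod_cast hlog.le) (ENNReal.log_monotone h)
  rwa [ENNReal.log_ofReal_of_pos (by positivity), Real.log_rpow hr, ← EReal.coe_div,
    mul_div_cancel_right₀ _ hlog.ne] at this

variable {X : Type*} [PseudoMetricSpace X] [MeasurableSpace X]

theorem le_upperLocalDim {μ : Measure X} {x : X} {t : ℝ}
    (h : ∃ᶠ r in 𝓝[>] (0 : ℝ), μ (Metric.ball x r) ≤ ENNReal.ofReal (r ^ t)) :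
    t ≤ upperLocalDim μ x := by
  refine le_limsup_of_frequently_le ?_ isBounded_le_of_top
  refine (h.and_eventually (Ioo_mem_nhdsGT one_pos)).mono ?_
  rintro r ⟨hr, hr0, hr1⟩
  exact le_log_div_log hr0 hr1 hr

theorem upperLocalDim_le {μ : Measure X} {x : X} {t : ℝ}
    (h : ∀ᶠ r in 𝓝[>] (0 : ℝ), ENNReal.ofReal (r ^ t) ≤ μ (Metric.ball x r)) :
    upperLocalDim μ x ≤ t := by
  refine limsup_le_of_le (h := ?_)
  filter_upwards [h, Ioo_mem_nhdsGT one_pos] with r hr hr01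
  exact log_div_log_le hr01.1 hr01.2 hr

theorem upperLocalDim_le_of_dyadic {μ : Measure X} {x : X} {t t' : ℝ} (ht : 0 ≤ t) (htt' : t < t')
    (h : ∀ᶠ n : ℕ in atTop,
      ENNReal.ofReal (((1 / 2 : ℝ) ^ n) ^ t) ≤ μ (Metric.ball x ((1 / 2) ^ n))) :
    upperLocalDim μ x ≤ t' := by
  obtain ⟨N, hN⟩ := eventually_atTop.1 h
  have hlim : Tendsto (fun r : ℝ => r ^ (t' - t)) (𝓝[>] 0) (𝓝 0) := by
    have := (Real.continuous_rpow_const (q := t' - t) (by linarith)).tendsto 0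
    rw [Real.zero_rpow (by linarith)] at this
    exact this.mono_left nhdsWithin_le_nhds
  refine upperLocalDim_le ?_
  filter_upwards [hlim.eventually_lt_const (by positivity : (0 : ℝ) < (1 / 2) ^ t),
    Ioo_mem_nhdsGT (by positivity : (0 : ℝ) < (1 / 2) ^ N), Ioo_mem_nhdsGT one_pos]
    with r hr hrN hr1
  obtain ⟨n, hn1, hn2⟩ := exists_nat_pow_near_of_lt_one hr1.1 hr1.2.le
    (by norm_num : (0 : ℝ) < 1 / 2) (by norm_num)
  have hNn : N ≤ n + 1 := by
    by_contra! hlt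
    have : (1 / 2 : ℝ) ^ N ≤ (1 / 2) ^ (n + 1) :=
      pow_le_pow_of_le_one (by norm_num) (by norm_num) hlt.le
    linarith [hrN.2]
  -- The factor `2 ^ t` lost in passing from `r` to the dyadic radius below it is absorbed by `r ^
  -- (t' - t)`.
  refine le_trans (ENNReal.ofReal_le_ofReal ?_)
    ((hN _ hNn).trans (measure_mono (Metric.ball_subset_ball hn1.le)))
  calc r ^ t' = r ^ (t' - t) * r ^ t := by rw [← Real.rpow_add hr1.1]; congr 1; ring
    _ ≤ (1 / 2) ^ t * ((1 / 2) ^ n) ^ t := by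
        have := hr1.1.le
        gcongr
    _ = ((1 / 2 : ℝ) ^ (n + 1)) ^ t := by
        rw [← Real.mul_rpow (by norm_num) (by positivity), pow_succ, mul_comm]

variable [CompactSpace X] [OpensMeasurableSpace X] {m : Measure X} {s : ℝ}

/-- The bad set is covered by `r`-balls about a maximal `r / 2`-separated subset of itself. Each has
mass below `r ^ t`, and disjointness of the `r / 4`-balls bounds their number by `O(r ^ (-s))`. -/
theorem measure_setOf_ball_lt_le {c : ℝ} (hc : 0 < c)
    (hlow : ∀ (x : X) (r : ℝ), 0 < r → r ≤ 1 → ENNReal.ofReal (c * r ^ s) ≤ m (Metric.ball x r))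
    (μ : Measure X) (t : ℝ) {r : ℝ} (hr : 0 < r) (hr1 : r ≤ 1) :
    μ {x | μ (Metric.ball x r) < ENNReal.ofReal (r ^ t)} ≤
      m univ * ENNReal.ofReal (4 ^ s / c * r ^ (t - s)) := by
  set A := {x | μ (Metric.ball x r) < ENNReal.ofReal (r ^ t)}
  obtain ⟨T, hTA, hT, hcov⟩ := exists_finset_separated_cover
    (isCompact_univ.totallyBounded.subset (subset_univ A)) (r := 2 * (r / 4)) (by positivity)
  have hcard := card_mul_le_measure (m := m) (K := univ) (s := s) MeasurableSet.univ
    (by simpa using hlow) (r := r / 4) (by positivity) (by linarith) (subset_univ _) hT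
  calc μ A ≤ μ (⋃ x ∈ T, Metric.ball x r) := by
        refine measure_mono (hcov.trans (iUnion₂_mono fun x _ => ?_))
        exact Metric.closedBall_subset_ball (by linarith)
    _ ≤ ∑ x ∈ T, μ (Metric.ball x r) := measure_biUnion_finset_le _ _
    _ ≤ ∑ x ∈ T, ENNReal.ofReal (r ^ t) := Finset.sum_le_sum fun x hx => (hTA hx).le
    _ = T.card * ENNReal.ofReal (c * (r / 4) ^ s) * ENNReal.ofReal (4 ^ s / c * r ^ (t - s)) := by
        rw [Finset.sum_const, nsmul_eq_mul, mul_assoc, ← ENNReal.ofReal_mul (by positivity)]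
        congr 2
        rw [Real.div_rpow hr.le (by norm_num), Real.rpow_sub hr]
        field_simp
    _ ≤ _ := by gcongr

/-- On a space carrying a measure whose mass of the ball `B(x, r)` is at least of order `r ^ s`,
every measure has upper local dimension at most `s` almost everywhere. -/
theorem ae_upperLocalDim_le [IsFiniteMeasure m] (hs : 0 < s) {c : ℝ} (hc : 0 < c)
    (hlow : ∀ (x : X) (r : ℝ), 0 < r → r ≤ 1 → ENNReal.ofReal (c * r ^ s) ≤ m (Metric.ball x r))
    (μ : Measure X) : ∀ᵐ x ∂μ, upperLocalDim μ x ≤ s := by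
  have step : ∀ t' : ℝ, s < t' → ∀ᵐ x ∂μ, upperLocalDim μ x ≤ t' := by
    intro t' ht'
    obtain ⟨t, hst, htt'⟩ := exists_between ht'
    -- Borel–Cantelli along dyadic radii: the bounds are geometric with ratio `(1 / 2) ^ (t - s) <
    -- 1`.
    have hsum : ∑' n : ℕ, μ {x | μ (Metric.ball x ((1 / 2) ^ n)) <
        ENNReal.ofReal (((1 / 2 : ℝ) ^ n) ^ t)} ≠ ∞ := by
      have hbound : ∀ n : ℕ, μ {x | μ (Metric.ball x ((1 / 2) ^ n)) <
          ENNReal.ofReal (((1 / 2 : ℝ) ^ n) ^ t)} ≤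
          m univ * ENNReal.ofReal (4 ^ s / c * ((1 / 2 : ℝ) ^ (t - s)) ^ n) := fun n => by
        rw [Real.rpow_pow_comm (by norm_num)]
        exact measure_setOf_ball_lt_le hc hlow μ t (by positivity)
          (pow_le_one₀ (by norm_num) (by norm_num))
      refine ne_top_of_le_ne_top ?_ (ENNReal.tsum_le_tsum hbound)
      rw [ENNReal.tsum_mul_left]
      refine ENNReal.mul_ne_top (measure_ne_top _ _) (Summable.tsum_ofReal_ne_top ?_)
      refine (summable_geometric_of_lt_one (by positivity) ?_).mul_left _
      exact Real.rpow_lt_one (by norm_num) (by norm_num) (by linarith)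
    filter_upwards [ae_eventually_notMem hsum] with x hx
    refine upperLocalDim_le_of_dyadic (hs.trans hst).le htt' (hx.mono fun n hn => ?_)
    simpa using hn
  have hall : ∀ᵐ x ∂μ, ∀ k : ℕ, upperLocalDim μ x ≤ ((s + 1 / ((k : ℝ) + 1) : ℝ) : EReal) :=
    ae_all_iff.2 fun k => step _ (by have : (0 : ℝ) < 1 / ((k : ℝ) + 1) := by positivity
                                     linarith)
  filter_upwards [hall] with x hx
  have hlim : Tendsto (fun k : ℕ => ((s + 1 / ((k : ℝ) + 1) : ℝ) : EReal)) atTop (𝓝 (s : EReal)) := by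
    refine (continuous_coe_real_ereal.tendsto s).comp ?_
    simpa using tendsto_one_div_add_atTop_nhds_zero_nat.const_add s
  exact ge_of_tendsto' hlim hx

end LocalDimension

/-! ### Light balls for typical measures -/

section Typical

variable {X : Type*}

theorem isOpen_setOf_measure_lt_of_isClosed [TopologicalSpace X] [HasOuterApproxClosed X]
    [MeasurableSpace X] [OpensMeasurableSpace X] {F : Set X} (hF : IsClosed F) (a : ℝ≥0∞) :
    IsOpen {μ : ProbabilityMeasure X | (μ : Measure X) F < a} := by
  refine isOpen_iff_mem_nhds.2 fun μ hμ => ?_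
  have := ProbabilityMeasure.limsup_measure_closed_le_of_tendsto
    (tendsto_id : Tendsto id (𝓝 μ) (𝓝 μ)) hF
  exact eventually_lt_of_limsup_lt (this.trans_lt hμ)

/-- The probability measures such that the balls of radius `r` have mass `O(r ^ s)`. -/
def frostmanMeasures (X : Type*) [PseudoMetricSpace X] [MeasurableSpace X] (s : ℝ) :
    Set (ProbabilityMeasure X) :=
  {μ | ∃ C : ℝ, ∀ (x : X) (r : ℝ), 0 < r →
    (μ : Measure X) (Metric.ball x r) ≤ ENNReal.ofReal (C * r ^ s)}

/-- The probability measures such that, for some `r < η`, all balls of radius `r` have mass at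
most `r ^ (s - η)`. -/
def smallBallMeasures (X : Type*) [PseudoMetricSpace X] [MeasurableSpace X] (s η : ℝ) :
    Set (ProbabilityMeasure X) :=
  {μ | ∃ r ∈ Ioo 0 η, ∀ x : X,
    (μ : Measure X) (Metric.ball x r) ≤ ENNReal.ofReal (r ^ (s - η))}

theorem le_upperLocalDim_of_smallBall [PseudoMetricSpace X] [MeasurableSpace X] {s : ℝ}
    {μ : ProbabilityMeasure X}
    (hμ : ∀ n : ℕ, μ ∈ smallBallMeasures X s (1 / ((n : ℝ) + 1))) (x : X) :
    s ≤ upperLocalDim (μ : Measure X) x := by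
  refine le_of_forall_lt fun a ha => ?_
  obtain ⟨t, hat, hts⟩ := EReal.lt_iff_exists_real_btwn.1 ha
  refine hat.trans_le (le_upperLocalDim ?_)
  have hts' : t < s := by exact_mod_cast hts
  refine (nhdsGT_basis (0 : ℝ)).frequently_iff.2 fun {ε} hε => ?_
  -- The three bounds place `r` below `ε`, make `r ^ ·` decreasing, and give `t ≤ s - 1 / (n + 1)`.
  obtain ⟨n, hn⟩ := exists_nat_one_div_lt (lt_min (lt_min hε one_pos) (sub_pos.2 hts'))
  obtain ⟨hn1, hn3⟩ := lt_min_iff.1 hn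
  obtain ⟨hn1, hn2⟩ := lt_min_iff.1 hn1
  obtain ⟨r, ⟨hr0, hr1⟩, hr⟩ := hμ n
  exact ⟨r, ⟨hr0, by linarith⟩, (hr x).trans (ENNReal.ofReal_le_ofReal
    (Real.rpow_le_rpow_of_exponent_ge hr0 (by linarith) (by linarith)))⟩

variable [PseudoMetricSpace X] [CompactSpace X] [MeasurableSpace X] [BorelSpace X] {s : ℝ}

/-- Every `r`-ball lies in a closed `2r`-ball about a point of a finite `r`-net. Strict bounds on
these finitely many closed balls form a weakly open condition, and a Frostman measure satisfies them
once `C * (3 * r) ^ s < r ^ (s - η)`. -/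
theorem frostmanMeasures_subset_interior {η : ℝ} (hη : 0 < η) :
    frostmanMeasures X s ⊆ interior (smallBallMeasures X s η) := by
  rintro μ ⟨C, hC⟩
  obtain ⟨r, ⟨hr0, hrη⟩, hr⟩ : ∃ r ∈ Ioo 0 η, C * (3 * r) ^ s < r ^ (s - η) := by
    have hlim : Tendsto (fun r : ℝ => C * 3 ^ s * r ^ η) (𝓝[>] 0) (𝓝 0) := by
      have h1 := (Real.continuous_rpow_const (q := η) hη.le).tendsto 0
      rw [Real.zero_rpow hη.ne'] at h1
      simpa using (h1.mono_left (nhdsWithin_le_nhds (s := Ioi 0))).const_mul (C * 3 ^ s)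
    obtain ⟨r, hr1, hr⟩ := ((hlim.eventually_lt_const one_pos).and (Ioo_mem_nhdsGT hη)).exists
    refine ⟨r, hr, ?_⟩
    have hr0 := hr.1
    calc C * (3 * r) ^ s = C * 3 ^ s * r ^ η * r ^ (s - η) := by
          rw [Real.mul_rpow (by norm_num) hr0.le, Real.rpow_sub hr0]
          field_simp
      _ < 1 * r ^ (s - η) := by gcongr
      _ = r ^ (s - η) := one_mul _
  obtain ⟨T, -, -, hcov⟩ := exists_finset_separated_cover
    (isCompact_univ (X := X)).totallyBounded hr0
  refine mem_interior.2 ⟨⋂ y ∈ T, {ν : ProbabilityMeasure X |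
    (ν : Measure X) (Metric.closedBall y (2 * r)) < ENNReal.ofReal (r ^ (s - η))}, ?_, ?_, ?_⟩
  · intro ν hν
    refine ⟨r, ⟨hr0, hrη⟩, fun x => ?_⟩
    obtain ⟨y, hy, hxy⟩ := mem_iUnion₂.1 (hcov (mem_univ x))
    refine le_trans (measure_mono fun z hz => ?_) (mem_iInter₂.1 hν y hy).le
    rw [Metric.mem_closedBall] at hxy ⊢
    have := Metric.mem_ball.1 hz
    linarith [dist_triangle z x y]
  · exact isOpen_biInter_finset fun y _ =>
      isOpen_setOf_measure_lt_of_isClosed Metric.isClosed_closedBall _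
  · refine mem_iInter₂.2 fun y _ => ?_
    refine lt_of_le_of_lt ((measure_mono (Metric.closedBall_subset_ball
      (by linarith : 2 * r < 3 * r))).trans (hC y (3 * r) (by positivity))) ?_
    exact (ENNReal.ofReal_lt_ofReal_iff (by positivity)).2 hr

variable {m : Measure X} [IsFiniteMeasure m]

/-- Cut the space into cells of diameter at most `ε` and spread the mass of each over an `ε`-ball
about one of its points, proportionally to `m`. Mass moves by less than `2 * ε`, and the lower bound
on `m` controls all the normalizations uniformly. -/
theorem exists_frostman_near {c₁ c₂ : ℝ} (hc₁ : 0 < c₁)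
    (hlow : ∀ (x : X) (r : ℝ), 0 < r → r ≤ 1 → ENNReal.ofReal (c₁ * r ^ s) ≤ m (Metric.ball x r))
    (hup : ∀ (x : X) (r : ℝ), 0 < r → m (Metric.ball x r) ≤ ENNReal.ofReal (c₂ * r ^ s))
    (μ : ProbabilityMeasure X) {ε : ℝ} (hε : 0 < ε) (hε1 : ε ≤ 1) :
    ∃ ν ∈ frostmanMeasures X s, ∀ B : Set X, MeasurableSet B →
      (ν : Measure X) B ≤ (μ : Measure X) (Metric.thickening (2 * ε) B) := by
  obtain ⟨A, hAm, hAb, hAd, hAu, hAdis⟩ :=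
    SeparableSpace.exists_measurable_partition_diam_le (Ω := X) hε
  have hX : Nonempty X := μ.nonempty
  have hy : ∀ n, ∃ y : X, ∀ x ∈ A n, dist x y ≤ ε := by
    intro n
    rcases (A n).eq_empty_or_nonempty with h | ⟨y, hy⟩
    · exact ⟨hX.some, by simp [h]⟩
    · exact ⟨y, fun x hx => (Metric.dist_le_diam_of_mem (hAb n) hx hy).trans (hAd n)⟩
  choose y hy using hy
  have hpos : ∀ n, m (Metric.ball (y n) ε) ≠ 0 := fun n => by
    refine (lt_of_lt_of_le ?_ (hlow (y n) ε hε hε1)).ne'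
    rw [ENNReal.ofReal_pos]
    positivity
  have hprob : ∀ n, IsProbabilityMeasure (ProbabilityTheory.cond m (Metric.ball (y n) ε)) :=
    fun n => ProbabilityTheory.cond_isProbabilityMeasure (hpos n)
  have hsumA : ∑' n, (μ : Measure X) (A n) = 1 := by
    rw [← measure_iUnion hAdis hAm, hAu, measure_univ]
  set ν : Measure X := Measure.sum fun n =>
    (μ : Measure X) (A n) • ProbabilityTheory.cond m (Metric.ball (y n) ε) with hν
  have hνB : ∀ B, MeasurableSet B → ν B =
      ∑' n, (μ : Measure X) (A n) * ProbabilityTheory.cond m (Metric.ball (y n) ε) B := by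
    intro B hB
    simp [hν, Measure.sum_apply _ hB]
  have hν1 : IsProbabilityMeasure ν := ⟨by
    rw [hνB _ MeasurableSet.univ]
    simpa using hsumA⟩
  refine ⟨⟨ν, hν1⟩, ⟨(c₁ * ε ^ s)⁻¹ * c₂, fun x r hr => ?_⟩, fun B hB => ?_⟩
  · change ν (Metric.ball x r) ≤ _
    rw [hνB _ Metric.isOpen_ball.measurableSet, mul_assoc, ENNReal.ofReal_mul (by positivity),
      ENNReal.ofReal_inv_of_pos (by positivity)]
    calc ∑' n, (μ : Measure X) (A n) *
          ProbabilityTheory.cond m (Metric.ball (y n) ε) (Metric.ball x r)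
        ≤ ∑' n, (μ : Measure X) (A n) *
          ((ENNReal.ofReal (c₁ * ε ^ s))⁻¹ * ENNReal.ofReal (c₂ * r ^ s)) := by
          refine ENNReal.tsum_le_tsum fun n => ?_
          rw [ProbabilityTheory.cond_apply Metric.isOpen_ball.measurableSet]
          gcongr
          · exact hlow _ _ hε hε1
          · exact (measure_mono inter_subset_right).trans (hup x r hr)
      _ = _ := by rw [ENNReal.tsum_mul_right, hsumA, one_mul]
  · change ν B ≤ _
    rw [hνB B hB]
    calc ∑' n, (μ : Measure X) (A n) * ProbabilityTheory.cond m (Metric.ball (y n) ε) B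
        ≤ ∑' n, (μ : Measure X) (A n ∩ Metric.thickening (2 * ε) B) := by
          refine ENNReal.tsum_le_tsum fun n => ?_
          -- A cell contributes to `ν B` only if its ball meets `B`, and then the whole cell lies in
          -- the thickening.
          rcases (Metric.ball (y n) ε ∩ B).eq_empty_or_nonempty with h | ⟨z, hz, hzB⟩
          · simp [ProbabilityTheory.cond_apply Metric.isOpen_ball.measurableSet, h]
          · have hsub : A n ⊆ Metric.thickening (2 * ε) B := fun x hx => by
              refine Metric.mem_thickening_iff.2 ⟨z, hzB, ?_⟩
              have h1 := hy n x hx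
              have h2 := Metric.mem_ball'.1 hz
              linarith [dist_triangle x (y n) z]
            rw [inter_eq_left.2 hsub]
            exact mul_le_of_le_one_right zero_le prob_le_one
      _ = (μ : Measure X) (Metric.thickening (2 * ε) B) := by
          rw [← measure_iUnion (fun i j hij => (hAdis hij).mono inter_subset_left inter_subset_left)
            (fun n => (hAm n).inter Metric.isOpen_thickening.measurableSet), ← iUnion_inter, hAu,
            univ_inter]

theorem dense_frostmanMeasures {c₁ c₂ : ℝ} (hc₁ : 0 < c₁)
    (hlow : ∀ (x : X) (r : ℝ), 0 < r → r ≤ 1 → ENNReal.ofReal (c₁ * r ^ s) ≤ m (Metric.ball x r))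
    (hup : ∀ (x : X) (r : ℝ), 0 < r → m (Metric.ball x r) ≤ ENNReal.ofReal (c₂ * r ^ s)) :
    Dense (frostmanMeasures X s) := by
  have hdense : Dense (LevyProkhorov.toMeasure ⁻¹' frostmanMeasures X s) := by
    refine Metric.dense_iff.2 fun P ε hε => ?_
    set δ := min (ε / 4) 1 with hδ
    have hδ0 : 0 < δ := by positivity
    obtain ⟨ν, hν, hle⟩ := exists_frostman_near hc₁ hlow hup P.toMeasure hδ0 (min_le_right _ _)
    refine ⟨LevyProkhorov.ofMeasure ν, ?_, hν⟩
    rw [Metric.mem_ball, LevyProkhorov.dist_probabilityMeasure_def]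
    refine lt_of_le_of_lt (levyProkhorovDist_le_of_forall_le _ _ (δ := 2 * δ) (by positivity) ?_)
      (by linarith [min_le_left (ε / 4) 1] : 2 * δ < ε)
    intro η B hη hB
    refine (hle B hB).trans (le_add_right (measure_mono (Metric.thickening_mono hη.le B)))
  have hsurj : Function.Surjective (LevyProkhorov.toMeasure (α := ProbabilityMeasure X)) :=
    LevyProkhorov.toMeasureEquiv.surjective
  have := hsurj.denseRange.dense_image LevyProkhorov.continuous_toMeasure_probabilityMeasure hdense
  rwa [image_preimage_eq _ hsurj] at this

theorem typically_ae_upperLocalDim_eq (hs : 0 < s) {c₁ c₂ : ℝ} (hc₁ : 0 < c₁)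
    (hlow : ∀ (x : X) (r : ℝ), 0 < r → r ≤ 1 → ENNReal.ofReal (c₁ * r ^ s) ≤ m (Metric.ball x r))
    (hup : ∀ (x : X) (r : ℝ), 0 < r → m (Metric.ball x r) ≤ ENNReal.ofReal (c₂ * r ^ s)) :
    Typically fun μ : ProbabilityMeasure X =>
      ∀ᵐ x ∂(μ : Measure X), upperLocalDim (μ : Measure X) x = s := by
  refine ⟨⋂ n : ℕ, interior (smallBallMeasures X s (1 / ((n : ℝ) + 1))),
    IsGδ.iInter_of_isOpen fun n => isOpen_interior, ?_, fun μ hμ => ?_⟩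
  · exact (dense_frostmanMeasures hc₁ hlow hup).mono
      (subset_iInter fun n => frostmanMeasures_subset_interior (by positivity))
  · filter_upwards [ae_upperLocalDim_le hs hc₁ hlow (μ : Measure X)] with x hx
    exact hx.antisymm (le_upperLocalDim_of_smallBall
      (fun n => interior_subset (mem_iInter.1 hμ n)) x)

end Typical

/-! ### From local regularity to uniform bounds, and the conclusion -/

theorem IsAhlforsRegular.exists_global_bounds {d : ℕ} {K : Set (EuclideanSpace ℝ (Fin d))}
    (hK : IsCompact K) (hreg : IsAhlforsRegular K) :
    ∃ s c₁ c₂ : ℝ, 0 < s ∧ 0 < c₁ ∧ K.Nonempty ∧ Measure.hausdorffMeasure s K ≠ ∞ ∧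
      (∀ x ∈ K, ∀ r : ℝ, 0 < r → r ≤ 1 →
        ENNReal.ofReal (c₁ * r ^ s) ≤ Measure.hausdorffMeasure s (K ∩ Metric.ball x r)) ∧
      ∀ x ∈ K, ∀ r : ℝ, 0 < r →
        Measure.hausdorffMeasure s (K ∩ Metric.ball x r) ≤ ENNReal.ofReal (c₂ * r ^ s) := by
  obtain ⟨s, c₁, c₂, r₀, hs, hc₁, hc₂, hr₀, hdim, hb⟩ := hreg
  have hne : K.Nonempty := by
    by_contra! h
    rw [h, dimH_empty] at hdim
    exact (ENNReal.ofReal_pos.2 hs).ne hdim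
  have hfin : Measure.hausdorffMeasure s K ≠ ∞ := by
    obtain ⟨T, hTK, -, hcov⟩ := exists_finset_separated_cover hK.totallyBounded
      (r := r₀ / 4) (by positivity)
    have hle : Measure.hausdorffMeasure s K ≤
        ∑ x ∈ T, Measure.hausdorffMeasure s (K ∩ Metric.ball x (r₀ / 2)) := by
      refine (measure_mono fun z hz => ?_).trans (measure_biUnion_finset_le _ _)
      obtain ⟨x, hx, hzx⟩ := mem_iUnion₂.1 (hcov hz)
      exact mem_iUnion₂.2 ⟨x, hx, hz, Metric.closedBall_subset_ball (by linarith) hzx⟩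
    refine ne_top_of_le_ne_top (ENNReal.sum_ne_top.2 fun x hx => ?_) hle
    exact ne_top_of_le_ne_top ENNReal.ofReal_ne_top
      (hb x (hTK hx) (r₀ / 2) (by positivity) (by linarith)).2
  -- For `r ≤ 1` the radius `ρ * r` is below `r₀` and at most `r`, so the local lower bound applies
  -- to it.
  set ρ := min (r₀ / 2) 1 with hρ
  have hρ0 : 0 < ρ := by positivity
  have hρr : ρ < r₀ := (min_le_left _ _).trans_lt (by linarith)
  set H := (Measure.hausdorffMeasure s K).toReal with hH
  refine ⟨s, c₁ * ρ ^ s, c₂ + H / r₀ ^ s, hs, by positivity, hne, hfin, ?_, ?_⟩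
  · intro x hx r hr hr1
    have hρr1 : ρ * r ≤ r := mul_le_of_le_one_left hr.le (min_le_right _ _)
    have := (hb x hx (ρ * r) (by positivity) (by nlinarith)).1
    rw [Real.mul_rpow hρ0.le hr.le, ← mul_assoc] at this
    exact this.trans (measure_mono (inter_subset_inter_right _ (Metric.ball_subset_ball hρr1)))
  · intro x hx r hr
    rcases lt_or_ge r r₀ with h | h
    · refine (hb x hx r hr h).2.trans (ENNReal.ofReal_le_ofReal ?_)
      gcongr
      exact le_add_of_nonneg_right (by positivity)
    · refine (measure_mono inter_subset_left).trans ?_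
      rw [← ENNReal.ofReal_toReal hfin]
      refine ENNReal.ofReal_le_ofReal ?_
      calc H = H / r₀ ^ s * r₀ ^ s := by field_simp
        _ ≤ (c₂ + H / r₀ ^ s) * r ^ s := by
          gcongr
          exact le_add_of_nonneg_left hc₂.le

end Fractal

theorem mainTheorem6 (d : ℕ) (K : Set (EuclideanSpace ℝ (Fin d))) (hK : IsCompact K)
    (hreg : Fractal.IsAhlforsRegular K) :
    Fractal.Typically fun μ : ProbabilityMeasure K =>
      (∀ᵐ x ∂(μ : Measure K),
        Fractal.upperLocalDim (μ : Measure K) x = (Fractal.packingDim K : EReal)) ∧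
      Fractal.IsUpperMonodimensional (μ : Measure K) := by
  obtain ⟨s, c₁, c₂, hs, hc₁, ⟨x₀, hx₀⟩, hfin, hlow, hup⟩ := hreg.exists_global_bounds hK
  have hKm : MeasurableSet K := hK.measurableSet
  have hpos : Measure.hausdorffMeasure s K ≠ 0 := by
    refine (lt_of_lt_of_le ?_ ((hlow x₀ hx₀ 1 one_pos le_rfl).trans
      (measure_mono inter_subset_left))).ne'
    rw [ENNReal.ofReal_pos]
    positivity
  have hdim : Fractal.packingDim K = ENNReal.ofReal s :=
    Fractal.packingDim_eq_of_regular hs hKm hK.totallyBounded hfin hpos hc₁ hlow hup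
  have : CompactSpace K := isCompact_iff_compactSpace.1 hK
  -- `H^s` is moved to the subtype, whose balls are the traces on `K` of ambient balls.
  set m : Measure K := Measure.comap Subtype.val (Measure.hausdorffMeasure s)
  have hball : ∀ (x : K) (r : ℝ),
      m (Metric.ball x r) = Measure.hausdorffMeasure s (K ∩ Metric.ball (x : _) r) := by
    intro x r
    rw [comap_subtype_coe_apply hKm, ← Subtype.preimage_ball, Subtype.image_preimage_coe]
  have : IsFiniteMeasure m := ⟨by
    rw [comap_subtype_coe_apply hKm, image_univ, Subtype.range_coe]
    exact hfin.lt_top⟩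
  obtain ⟨S, hS, hSd, h⟩ := Fractal.typically_ae_upperLocalDim_eq (m := m) hs hc₁
    (fun x r hr hr1 => (hball x r).symm ▸ hlow x x.2 r hr hr1)
    (fun x r hr => (hball x r).symm ▸ hup x x.2 r hr)
  refine ⟨S, hS, hSd, fun μ hμ => ⟨?_, s, h μ hμ⟩⟩
  rw [hdim, EReal.coe_ennreal_ofReal, max_eq_left hs.le]
  exact h μ hμ
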